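/- Let $A$, $X$ and $B_1,B_2,\dots$ be random variables with values in $\{0,1,2,\dots\}$ on a probability space such that the $B_i$ are i.i.d. (write $B$ for a generic one), $X$ is independent of $(B_i)_{i\ge1}$, $A$ is independent of $(X,(B_i)_{i\ge1})$, and $$X \overset{d}{=} A+\sum_{i=1}^{X}B_i .$$ Assume that 1. $P(A>x)\sim (1+x)^{-1}$ as $x\to\infty$; 2. $P(B>x)=\dfrac{L(x)}{1+x}$ for all real $x>0$, where $L:(0,\infty)\to(0,\infty)$ is measurable and slowly varying (that is, $L(tx)/L(x)\to1$ as $x\to\infty$ for every $t>0$) and $L(x)\sim(\log x)^{-1-\varepsilon}$ as $x\to\infty$ for some $\varepsilon>0$; 3. $b:=E[B]\in(0,1)$. Then, as $x\to\infty$ through the reals, $$P(X>x)\sim\frac{1}{1-b}\,P(A>x)\sim\frac{1}{(1-b)(1+x)} .$$ Moreover, the series $S(x)=\sum_{n\ge1}n\,b^{n-1}\log(x\,b^{-n})$ converges for every $x>0$, and $$P(X>x)\sim\frac{1}{(1-b)(1+x)}+S(x)\,\frac{L(x)}{1+x}\,(1+o(1))$$ for every choice of the $o(1)$ term, where $\sim$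 means that the ratio of the two sides tends to $1$. The correction term $S(x)\,L(x)/(1+x)$ is of exact order $L(x)\log x/(1+x)$, i.e. the quotient of the two is eventually bounded and bounded away from $0$, and $$\frac{L(x)\log x}{1+x}=o\!\left(\frac1{1+x}\right),$$ so the correction is asymptotically negligible. -/

import Mathlib

open MeasureTheory ProbabilityTheory Filter Asymptotics Topology

noncomputable section

/-- The tail `x ↦ P(Y > x)` of a random variable `Y` with values in `{0, 1, 2, …}`, as a
function of a real variable. -/
def tail {Ω : Type*} [MeasurableSpace Ω] (μ : Measure Ω) (Y : Ω → ℕ) (x : ℝ) : ℝ :=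
  μ.real {ω | x < (Y ω : ℝ)}

/-- `L : (0,∞) → (0,∞)` is measurable and slowly varying at infinity (the values of `L` off
`(0,∞)` play no role). -/
structure IsSlowlyVarying (L : ℝ → ℝ) : Prop where
  measurable : Measurable fun x : Set.Ioi (0 : ℝ) => L x
  pos : ∀ x, 0 < x → 0 < L x
  tendsto_ratio : ∀ t, 0 < t → Tendsto (fun x => L (t * x) / L x) atTop (𝓝 1)

/-- `X` is a solution of the fixed-point equation `X =_d A + ∑_{i=1}^X B_i`, where on the
right-hand side `X`, `A`, `B_1, B_2, …` are independent and the `B_i` are identically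
distributed. The summands `B_1, B_2, …` are written `B 0, B 1, …`. -/
structure IsStationarySolution {Ω : Type*} [MeasurableSpace Ω] (μ : Measure Ω)
    (X A : Ω → ℕ) (B : ℕ → Ω → ℕ) : Prop where
  measurable_X : Measurable X
  measurable_A : Measurable A
  measurable_B : ∀ i, Measurable (B i)
  iIndep_B : iIndepFun B μ
  identDistrib_B : ∀ i, IdentDistrib (B i) (B 0) μ μ
  indep_X : IndepFun X (fun ω i => B i ω) μ
  indep_A : IndepFun A (fun ω => (X ω, fun i => B i ω)) μ
  fixed_point : IdentDistrib X (fun ω => A ω + ∑ i ∈ Finset.range (X ω), B i ω) μ μ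

/-- The term of index `n + 1` of the series `∑_{n ≥ 1} n b^{n-1} log (x b^{-n})`. -/
def refinementTerm (b x : ℝ) (n : ℕ) : ℝ :=
  ((n : ℝ) + 1) * b ^ n * Real.log (x / b ^ (n + 1))

/-- The series `∑_{n ≥ 1} n b^{n-1} log (x b^{-n})`. -/
def refinementCoeff (b x : ℝ) : ℝ :=
  ∑' n : ℕ, refinementTerm b x n

end

/-! Write `S` for the random sum. The sum `A + S` is large essentially when one of its terms is, and
`S` exceeds `x` essentially when `X` exceeds `x / b`. So the tail nearly satisfies `P(X > x) ≈ P(A >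
x) + P(X > x / b)`, and iterating gives `(1 + b + b² + ⋯) / x`.

Upper bound (`eventually_tail_le`): by `tail_randomSum_le`, `S > y` needs either `X > m`, with `m`
slightly below `y / b`, or an atypical sum of at most `m` summands. Chebyshev for summands truncated
at `y` bounds the latter by `E[X; X ≤ m]` times a factor that is `o(1 / (y log y))` by the
hypothesis on `B`. Although `X` has infinite mean, truncating the fixed-point equation gives `E[X; X
≤ m] = O(log m)` (`one_sub_mul_integral_truncated_le`), so this contribution is `o(1 / y)`. Lower
bound (`eventually_le_tail`): the law of large numbers makes `S > y` likely once `X > y / d` with `d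
< b`.

Both bounds are recursions `D x ≤ θ * D (x / β)` for the difference `D` between the tail and `K /
x`; since `D → 0`, `nonpos_of_le_mul_comp_div` gives `D ≤ 0`. The two-scale form then follows
because the correction is `O(L(x) log x / x) = o(1 / x)`. -/

open scoped ENNReal

/-! ### Tails and truncated moments -/

section Tail

variable {Ω : Type*} [MeasurableSpace Ω] {μ : Measure Ω}

theorem measurableSet_tail {Y : Ω → ℕ} (hY : Measurable Y) (x : ℝ) :
    MeasurableSet {ω | x < (Y ω : ℝ)} :=
  measurableSet_lt measurable_const (measurable_from_top.comp hY)

theorem tail_nonneg (Y : Ω → ℕ) (x : ℝ) : 0 ≤ tail μ Y x := measureReal_nonneg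

theorem tail_le_one [IsProbabilityMeasure μ] (Y : Ω → ℕ) (x : ℝ) : tail μ Y x ≤ 1 :=
  measureReal_le_one

theorem tail_antitone [IsFiniteMeasure μ] (Y : Ω → ℕ) : Antitone (tail μ Y) :=
  fun _ _ hxy => measureReal_mono fun _ h => lt_of_le_of_lt hxy h

theorem tail_eq_of_identDistrib {Y Z : Ω → ℕ} (h : IdentDistrib Y Z μ μ) (x : ℝ) :
    tail μ Y x = tail μ Z x := by
  have hs : MeasurableSet {n : ℕ | x < (n : ℝ)} := trivial
  have := h.measure_mem_eq hs
  simp only [tail, measureReal_def]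
  exact congrArg ENNReal.toReal this

theorem tendsto_tail [IsFiniteMeasure μ] {Y : Ω → ℕ} (hY : Measurable Y) :
    Tendsto (tail μ Y) atTop (𝓝 0) := by
  have hanti : Antitone fun x : ℝ => {ω | x < (Y ω : ℝ)} :=
    fun x y hxy ω (h : y < _) => lt_of_le_of_lt hxy h
  have h := tendsto_measure_iInter_atTop (μ := μ) (s := fun x : ℝ => {ω | x < (Y ω : ℝ)})
    (fun x => (measurableSet_tail hY x).nullMeasurableSet) hanti ⟨0, measure_ne_top _ _⟩
  have he : (⋂ x : ℝ, {ω | x < (Y ω : ℝ)}) = ∅ := by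
    ext ω
    simp only [Set.mem_iInter, Set.mem_ofPred_eq, Set.mem_empty_iff_false, iff_false, not_forall,
      not_lt]
    exact ⟨Y ω, le_rfl⟩
  rw [he, measure_empty] at h
  exact (ENNReal.tendsto_toReal ENNReal.zero_ne_top).comp h

/-- A power weight of a truncated natural number is a sum over levels. -/
theorem sum_range_ite_lt (g : ℕ → ℝ) (a N : ℕ) :
    ∑ k ∈ Finset.range N, (if k < a then g k else 0) = ∑ k ∈ Finset.range (min a N), g k := by
  rw [← Finset.sum_filter]
  congr 1
  ext k
  simp [and_comm]

/-- Discrete layer-cake formula; the weights `1` and `2k + 1` yield the first two moments.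
Truncation at `N` avoids any moment assumption on `Y`. -/
theorem integral_sum_range_min [IsFiniteMeasure μ] {Y : Ω → ℕ} (hY : Measurable Y) (g : ℕ → ℝ)
    (N : ℕ) :
    ∫ ω, (∑ k ∈ Finset.range (min (Y ω) N), g k) ∂μ = ∑ k ∈ Finset.range N, g k * tail μ Y k := by
  have hset : ∀ k : ℕ, MeasurableSet {ω | (k : ℝ) < Y ω} := fun k => measurableSet_tail hY k
  have h : ∀ ω, ∑ k ∈ Finset.range (min (Y ω) N), g k =
      ∑ k ∈ Finset.range N, {ω | (k : ℝ) < Y ω}.indicator (fun _ => g k) ω := by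
    intro ω
    rw [← sum_range_ite_lt]
    refine Finset.sum_congr rfl fun k _ => ?_
    simp [Set.indicator_apply]
  simp_rw [h]
  rw [integral_finsetSum _ fun k _ => (integrable_const _).indicator (hset k)]
  refine Finset.sum_congr rfl fun k _ => ?_
  rw [integral_indicator_const _ (hset k), smul_eq_mul, mul_comm, tail]

theorem integral_min_eq_sum_tail [IsFiniteMeasure μ] {Y : Ω → ℕ} (hY : Measurable Y) (N : ℕ) :
    ∫ ω, ((min (Y ω) N : ℕ) : ℝ) ∂μ = ∑ k ∈ Finset.range N, tail μ Y k := by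
  simpa using integral_sum_range_min (μ := μ) hY (fun _ => 1) N

theorem integral_min_sq_eq_sum_tail [IsFiniteMeasure μ] {Y : Ω → ℕ} (hY : Measurable Y) (N : ℕ) :
    ∫ ω, ((min (Y ω) N : ℕ) : ℝ) ^ 2 ∂μ =
      ∑ k ∈ Finset.range N, (2 * (k : ℝ) + 1) * tail μ Y k := by
  rw [← integral_sum_range_min hY fun k => 2 * (k : ℝ) + 1]
  refine integral_congr_ae (Eventually.of_forall fun ω => ?_)
  have : ∀ n : ℕ, ∑ k ∈ Finset.range n, (2 * (k : ℝ) + 1) = (n : ℝ) ^ 2 := by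
    intro n
    induction n with
    | zero => simp
    | succ n ih => rw [Finset.sum_range_succ, ih]; push_cast; ring
  exact (this _).symm

/-- Markov's inequality for the tail. -/
theorem mul_tail_le_integral [IsFiniteMeasure μ] {Y : Ω → ℕ}
    (hint : Integrable (fun ω => (Y ω : ℝ)) μ) {x : ℝ} (hx : 0 ≤ x) :
    x * tail μ Y x ≤ ∫ ω, (Y ω : ℝ) ∂μ := by
  refine le_trans (mul_le_mul_of_nonneg_left (measureReal_mono fun ω (h : x < Y ω) => ?_) hx)
    (mul_meas_ge_le_integral_of_nonneg (Eventually.of_forall fun ω => Nat.cast_nonneg _) hint x)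
  exact le_of_lt h

end Tail

/-! ### Conditioning on `X` and the truncated first moment -/

section StationarySolution

variable {Ω : Type*} [MeasurableSpace Ω] {μ : Measure Ω} [IsProbabilityMeasure μ]
  {X A : Ω → ℕ} {B : ℕ → Ω → ℕ}

namespace IsStationarySolution

omit [IsProbabilityMeasure μ] in
theorem measurable_sum (hX : IsStationarySolution μ X A B) (n : ℕ) :
    Measurable fun ω => ∑ i ∈ Finset.range n, B i ω :=
  Finset.measurable_sum _ fun i _ => hX.measurable_B i

omit [IsProbabilityMeasure μ] in
theorem measurable_randomSum (hX : IsStationarySolution μ X A B) :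
    Measurable fun ω => ∑ i ∈ Finset.range (X ω), B i ω := by
  have h : Measurable fun p : ℕ × Ω => ∑ i ∈ Finset.range p.1, B i p.2 :=
    measurable_from_prod_countable_right fun n => hX.measurable_sum n
  exact h.comp (hX.measurable_X.prodMk measurable_id)

/-- Conditioning on `X`, which is independent of `B`. -/
theorem lintegral_comp_prod (hX : IsStationarySolution μ X A B) (H : ℕ → (ℕ → ℕ) → ℝ≥0∞)
    (hH : ∀ n, Measurable (H n)) :
    ∫⁻ ω, H (X ω) (fun i => B i ω) ∂μ = ∫⁻ ω', ∫⁻ ω, H (X ω') (fun i => B i ω) ∂μ ∂μ := by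
  have hB : Measurable fun ω i => B i ω := measurable_pi_lambda _ hX.measurable_B
  have hH' : Measurable fun p : ℕ × (ℕ → ℕ) => H p.1 p.2 :=
    measurable_from_prod_countable_right hH
  have hprod := (indepFun_iff_map_prod_eq_prod_map_map hX.measurable_X.aemeasurable
    hB.aemeasurable).1 hX.indep_X
  rw [← lintegral_map (f := fun p : ℕ × (ℕ → ℕ) => H p.1 p.2)
    (g := fun ω => (X ω, fun i => B i ω)) hH' (hX.measurable_X.prodMk hB), hprod,
    lintegral_prod _ hH'.aemeasurable, lintegral_map measurable_from_top hX.measurable_X]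
  refine lintegral_congr fun ω' => ?_
  rw [lintegral_map (hH _) hB]

theorem measure_randomSum (hX : IsStationarySolution μ X A B) (y : ℝ) :
    μ {ω | y < ((∑ i ∈ Finset.range (X ω), B i ω : ℕ) : ℝ)} =
      ∫⁻ ω', μ {ω | y < ((∑ i ∈ Finset.range (X ω'), B i ω : ℕ) : ℝ)} ∂μ := by
  have hm : ∀ n, MeasurableSet {β : ℕ → ℕ | y < ((∑ i ∈ Finset.range n, β i : ℕ) : ℝ)} := fun n =>
    measurableSet_tail (Finset.measurable_sum _ fun i _ => measurable_pi_apply i) y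
  have h := hX.lintegral_comp_prod
    (fun n => {β : ℕ → ℕ | y < ((∑ i ∈ Finset.range n, β i : ℕ) : ℝ)}.indicator 1)
    fun n => measurable_one.indicator (hm n)
  rw [← lintegral_indicator_one (measurableSet_tail hX.measurable_randomSum y)]
  refine h.trans (lintegral_congr fun ω' => ?_)
  exact lintegral_indicator_one (measurableSet_tail (hX.measurable_sum _) y)

omit [IsProbabilityMeasure μ] in
theorem lintegral_sum (hX : IsStationarySolution μ X A B) (n : ℕ) :
    ∫⁻ ω, ((∑ i ∈ Finset.range n, B i ω : ℕ) : ℝ≥0∞) ∂μ = n * ∫⁻ ω, (B 0 ω : ℝ≥0∞) ∂μ := by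
  have hm : ∀ i, Measurable fun ω => (B i ω : ℝ≥0∞) := fun i =>
    measurable_from_top.comp (hX.measurable_B i)
  simp_rw [Nat.cast_sum]
  rw [lintegral_finsetSum _ fun i _ => hm i,
    Finset.sum_congr rfl fun i _ => show ∫⁻ ω, (B i ω : ℝ≥0∞) ∂μ = ∫⁻ ω, (B 0 ω : ℝ≥0∞) ∂μ from
      ((hX.identDistrib_B i).comp (u := fun k : ℕ => (k : ℝ≥0∞)) measurable_from_top).lintegral_eq]
  simp

-- A non-integrable function has Bochner integral `0`, so a positive mean already encodes
-- integrability.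
omit [IsProbabilityMeasure μ] in
theorem integrable_B (hX : IsStationarySolution μ X A B) (hb : 0 < ∫ ω, (B 0 ω : ℝ) ∂μ) (i : ℕ) :
    Integrable (fun ω => (B i ω : ℝ)) μ := by
  have h0 : Integrable (fun ω => (B 0 ω : ℝ)) μ := by
    by_contra h
    rw [integral_undef h] at hb
    exact lt_irrefl _ hb
  exact ((hX.identDistrib_B i).comp (u := fun k : ℕ => (k : ℝ))
    measurable_from_top).integrable_iff.2 h0

/-- The truncated first moment of `X` is controlled by that of `A`. -/
theorem one_sub_mul_integral_truncated_le (hX : IsStationarySolution μ X A B)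
    (hb0 : 0 < ∫ ω, (B 0 ω : ℝ) ∂μ) (hb1 : ∫ ω, (B 0 ω : ℝ) ∂μ < 1) (M : ℕ) :
    (1 - ∫ ω, (B 0 ω : ℝ) ∂μ) * ∫ ω, (if X ω ≤ M then (X ω : ℝ) else 0) ∂μ ≤
      ∑ k ∈ Finset.range M, tail μ A k := by
  set b := ∫ ω, (B 0 ω : ℝ) ∂μ with hb
  have hbE : ∫⁻ ω, (B 0 ω : ℝ≥0∞) ∂μ = ENNReal.ofReal b := by
    rw [hb, ofReal_integral_eq_lintegral_ofReal (hX.integrable_B hb0 0)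
      (Eventually.of_forall fun ω => Nat.cast_nonneg _)]
    simp
  set S : Ω → ℕ := fun ω => ∑ i ∈ Finset.range (X ω), B i ω with hS
  have hXm := hX.measurable_X
  have hcast : ∀ n : ℕ, ((min n M : ℕ) : ℝ≥0∞) = min (n : ℝ≥0∞) M := fun n =>
    (Nat.mono_cast (α := ℝ≥0∞)).map_min
  have hmeas : ∀ {Y : Ω → ℕ}, Measurable Y → ∀ f : ℕ → ℝ≥0∞, Measurable fun ω => f (Y ω) :=
    fun hY f => measurable_from_top.comp hY
  have hfix : ∫⁻ ω, min (X ω : ℝ≥0∞) M ∂μ = ∫⁻ ω, min ((A ω + S ω : ℕ) : ℝ≥0∞) M ∂μ :=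
    (hX.fixed_point.comp (u := fun k : ℕ => min (k : ℝ≥0∞) M) measurable_from_top).lintegral_eq
  -- Jensen for the concave map `min · M`, conditionally on `X`.
  have hsum : ∫⁻ ω, min (S ω : ℝ≥0∞) M ∂μ ≤ ∫⁻ ω, min (ENNReal.ofReal b * X ω) M ∂μ := by
    have h := hX.lintegral_comp_prod
      (fun n β => min ((∑ i ∈ Finset.range n, β i : ℕ) : ℝ≥0∞) M) fun n =>
        (measurable_from_top.comp
          (Finset.measurable_sum _ fun i _ => measurable_pi_apply i)).min measurable_const
    refine h.le.trans (lintegral_mono fun ω' => le_min ?_ ?_)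
    · refine (lintegral_mono fun ω => min_le_left _ _).trans ?_
      rw [hX.lintegral_sum, hbE, mul_comm]
    · refine (lintegral_mono fun ω => min_le_right _ _).trans ?_
      simp
  -- Pointwise: for `X ≤ M` this is `(1 - b) X + b X = X`; for `X > M` the right side is already
  -- `M`.
  have hlow : ∫⁻ ω, ENNReal.ofReal (1 - b) * (if X ω ≤ M then (X ω : ℝ≥0∞) else 0) ∂μ +
      ∫⁻ ω, min (ENNReal.ofReal b * X ω) M ∂μ ≤ ∫⁻ ω, min (X ω : ℝ≥0∞) M ∂μ := by
    rw [← lintegral_add_left (hmeas hXm fun n => ENNReal.ofReal (1 - b) *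
      (if n ≤ M then (n : ℝ≥0∞) else 0))]
    refine lintegral_mono fun ω => ?_
    dsimp only
    split_ifs with h
    · have h1 : ENNReal.ofReal (1 - b) * (X ω : ℝ≥0∞) + ENNReal.ofReal b * X ω = X ω := by
        rw [← add_mul, ← ENNReal.ofReal_add (by linarith) hb0.le]
        simp
      have hM : (X ω : ℝ≥0∞) ≤ M := by exact_mod_cast h
      rw [min_eq_left hM]
      exact (add_le_add_right (min_le_left _ _) _).trans h1.le
    · have hM : (M : ℝ≥0∞) ≤ X ω := by exact_mod_cast (not_le.1 h).le
      simp [hM]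
  have hup : ∫⁻ ω, min ((A ω + S ω : ℕ) : ℝ≥0∞) M ∂μ ≤
      ∫⁻ ω, min (A ω : ℝ≥0∞) M ∂μ + ∫⁻ ω, min (S ω : ℝ≥0∞) M ∂μ := by
    rw [← lintegral_add_left (hmeas hX.measurable_A fun n => min (n : ℝ≥0∞) M)]
    refine lintegral_mono fun ω => ?_
    have : min (A ω + S ω) M ≤ min (A ω) M + min (S ω) M := by omega
    have h2 : ((min (A ω + S ω) M : ℕ) : ℝ≥0∞) ≤ ((min (A ω) M + min (S ω) M : ℕ) : ℝ≥0∞) := by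
      exact_mod_cast this
    rwa [Nat.cast_add, hcast, hcast, hcast] at h2
  -- Truncation makes this term finite, so it can be cancelled even though `E[X]` may be infinite.
  have hfin : ∫⁻ ω, min (ENNReal.ofReal b * X ω) M ∂μ ≠ ∞ := by
    refine ne_top_of_le_ne_top (ENNReal.natCast_ne_top M) ?_
    refine (lintegral_mono fun ω => min_le_right _ _).trans ?_
    simp
  have hmain : ∫⁻ ω, ENNReal.ofReal (1 - b) * (if X ω ≤ M then (X ω : ℝ≥0∞) else 0) ∂μ ≤
      ∫⁻ ω, min (A ω : ℝ≥0∞) M ∂μ := by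
    refine (ENNReal.add_le_add_iff_right hfin).1 ?_
    refine hlow.trans (hfix.le.trans (hup.trans ?_))
    gcongr
  rw [← integral_min_eq_sum_tail hX.measurable_A, ← integral_const_mul]
  rw [integral_eq_lintegral_of_nonneg_ae, integral_eq_lintegral_of_nonneg_ae]
  · have hAfin : ∫⁻ ω, min (A ω : ℝ≥0∞) M ∂μ ≠ ∞ := by
      refine ne_top_of_le_ne_top (ENNReal.natCast_ne_top M) ?_
      refine (lintegral_mono fun ω => min_le_right _ _).trans ?_
      simp
    have e1 : ∀ ω, ENNReal.ofReal ((min (A ω) M : ℕ) : ℝ) = min (A ω : ℝ≥0∞) M := by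
      intro ω
      rw [ENNReal.ofReal_natCast, hcast]
    have e2 : ∀ ω, ENNReal.ofReal ((1 - b) * (if X ω ≤ M then (X ω : ℝ) else 0)) =
        ENNReal.ofReal (1 - b) * (if X ω ≤ M then (X ω : ℝ≥0∞) else 0) := by
      intro ω
      rw [ENNReal.ofReal_mul (by linarith)]
      split_ifs <;> simp
    simp_rw [e1, e2]
    exact ENNReal.toReal_mono hAfin hmain
  · exact Eventually.of_forall fun ω => Nat.cast_nonneg _
  · exact ((measurable_from_top (f := fun n : ℕ => ((min n M : ℕ) : ℝ))).comp
      hX.measurable_A).aestronglyMeasurable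
  · refine Eventually.of_forall fun ω => mul_nonneg (by linarith) ?_
    split_ifs <;> simp
  · exact ((measurable_from_top (f := fun n : ℕ => (1 - b) *
      (if n ≤ M then (n : ℝ) else 0))).comp hXm).aestronglyMeasurable

end IsStationarySolution

end StationarySolution

/-! ### Tail of the random sum and its comparison with `X` -/

section StationarySolution

variable {Ω : Type*} [MeasurableSpace Ω] {μ : Measure Ω} [IsProbabilityMeasure μ]
  {X A : Ω → ℕ} {B : ℕ → Ω → ℕ}

namespace IsStationarySolution

/-- One big jump or a large deviation of the truncated sum. -/
theorem tail_sum_le (hX : IsStationarySolution μ X A B) (hb0 : 0 < ∫ ω, (B 0 ω : ℝ) ∂μ) {n : ℕ}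
    {y c : ℝ} (hc : 0 < c) (hn : n * ∫ ω, (B 0 ω : ℝ) ∂μ + c ≤ y) :
    tail μ (fun ω => ∑ i ∈ Finset.range n, B i ω) y ≤
      n * (tail μ (B 0) y +
        (∑ k ∈ Finset.range ⌊y⌋₊, (2 * (k : ℝ) + 1) * tail μ (B 0) k) / c ^ 2) := by
  have hy : 0 ≤ y := le_trans (by positivity) hn
  set N := ⌊y⌋₊ with hN
  set f : ℕ → ℝ := fun k => ((min k N : ℕ) : ℝ) with hf
  have hfm : Measurable f := measurable_from_top
  set Y : ℕ → Ω → ℝ := fun i => f ∘ B i with hY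
  have hYm : ∀ i, Measurable (Y i) := fun i => hfm.comp (hX.measurable_B i)
  have hYbd : ∀ i ω, ‖Y i ω‖ ≤ N := by
    intro i ω
    simp only [hY, hf, Function.comp_apply, Real.norm_natCast]
    exact_mod_cast min_le_right _ _
  have hYL : ∀ i, MemLp (Y i) 2 μ := fun i =>
    MemLp.of_bound (hYm i).aestronglyMeasurable N (Eventually.of_forall (hYbd i))
  have hid : ∀ i, IdentDistrib (Y i) (Y 0) μ μ := fun i => (hX.identDistrib_B i).comp hfm
  have hmean : ∀ i, ∫ ω, Y i ω ∂μ ≤ ∫ ω, (B 0 ω : ℝ) ∂μ := by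
    intro i
    rw [(hid i).integral_eq]
    refine integral_mono ((hYL 0).integrable one_le_two) (hX.integrable_B hb0 0) fun ω => ?_
    simp only [hY, hf, Function.comp_apply]
    exact_mod_cast min_le_left _ _
  have hvar : ∀ i, Var[Y i; μ] ≤ ∑ k ∈ Finset.range N, (2 * (k : ℝ) + 1) * tail μ (B 0) k := by
    intro i
    rw [(hid i).variance_eq, ← integral_min_sq_eq_sum_tail (hX.measurable_B 0)]
    exact variance_le_expectation_sq (hYm 0).aestronglyMeasurable
  have hsumL : MemLp (∑ i ∈ Finset.range n, Y i) 2 μ := memLp_finsetSum' _ fun i _ => hYL i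
  have hsumvar : Var[∑ i ∈ Finset.range n, Y i; μ] ≤
      n * ∑ k ∈ Finset.range N, (2 * (k : ℝ) + 1) * tail μ (B 0) k := by
    rw [IndepFun.variance_sum (fun i _ => hYL i) fun i _ j _ hij =>
      (hX.iIndep_B.indepFun hij).comp hfm hfm]
    refine (Finset.sum_le_sum fun i _ => hvar i).trans_eq ?_
    simp
  have hsummean : ∫ ω, (∑ i ∈ Finset.range n, Y i) ω ∂μ ≤ n * ∫ ω, (B 0 ω : ℝ) ∂μ := by
    simp_rw [Finset.sum_apply]
    rw [integral_finsetSum _ fun i _ => (hYL i).integrable one_le_two]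
    refine (Finset.sum_le_sum fun i _ => hmean i).trans_eq ?_
    simp
  have hcheb : μ.real {ω | c ≤ |(∑ i ∈ Finset.range n, Y i) ω -
      ∫ ω, (∑ i ∈ Finset.range n, Y i) ω ∂μ|} ≤
        n * (∑ k ∈ Finset.range N, (2 * (k : ℝ) + 1) * tail μ (B 0) k) / c ^ 2 := by
    refine ENNReal.toReal_le_of_le_ofReal ?_
      ((meas_ge_le_variance_div_sq hsumL hc).trans (ENNReal.ofReal_le_ofReal ?_))
    · exact div_nonneg (mul_nonneg (Nat.cast_nonneg _) (Finset.sum_nonneg fun k _ =>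
        mul_nonneg (by positivity) (tail_nonneg _ _))) (sq_nonneg _)
    · gcongr
  -- If no summand exceeds `y`, truncation at `⌊y⌋₊` changes nothing, and the sum exceeds its
  -- truncated mean, at most `n b`, by more than `y - n b ≥ c`.
  have hsub : {ω | y < ((∑ i ∈ Finset.range n, B i ω : ℕ) : ℝ)} ⊆
      (⋃ i ∈ Finset.range n, {ω | y < (B i ω : ℝ)}) ∪
        {ω | c ≤ |(∑ i ∈ Finset.range n, Y i) ω -
          ∫ ω, (∑ i ∈ Finset.range n, Y i) ω ∂μ|} := by
    intro ω (hω : y < ((∑ i ∈ Finset.range n, B i ω : ℕ) : ℝ))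
    by_cases h : ∃ i ∈ Finset.range n, y < (B i ω : ℝ)
    · obtain ⟨i, hi, hlt⟩ := h
      exact Or.inl (Set.mem_biUnion hi hlt)
    · push Not at h
      refine Or.inr ?_
      have he : (∑ i ∈ Finset.range n, Y i) ω = ((∑ i ∈ Finset.range n, B i ω : ℕ) : ℝ) := by
        rw [Finset.sum_apply, Nat.cast_sum]
        refine Finset.sum_congr rfl fun i hi => ?_
        simp only [hY, hf, Function.comp_apply]
        rw [min_eq_left (Nat.le_floor (h i hi))]
      show c ≤ |_|
      rw [he]
      refine le_trans ?_ (le_abs_self _)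
      linarith
  have hB : ∀ i, μ.real {ω | y < (B i ω : ℝ)} = tail μ (B 0) y := fun i =>
    tail_eq_of_identDistrib (hX.identDistrib_B i) y
  calc tail μ (fun ω => ∑ i ∈ Finset.range n, B i ω) y
      ≤ _ := measureReal_mono hsub
    _ ≤ _ := measureReal_union_le _ _
    _ ≤ _ := add_le_add (measureReal_biUnion_finset_le _ _) hcheb
    _ = _ := by
      simp only [hB, Finset.sum_const, Finset.card_range, nsmul_eq_mul]
      ring

/-- Upper bound for the tail of the random sum by that of `X`. -/
theorem tail_randomSum_le (hX : IsStationarySolution μ X A B)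
    (hb0 : 0 < ∫ ω, (B 0 ω : ℝ) ∂μ) {m y c : ℝ} (hc : 0 < c)
    (hmy : m * ∫ ω, (B 0 ω : ℝ) ∂μ + c ≤ y) :
    tail μ (fun ω => ∑ i ∈ Finset.range (X ω), B i ω) y ≤
      tail μ X m + (tail μ (B 0) y +
        (∑ k ∈ Finset.range ⌊y⌋₊, (2 * (k : ℝ) + 1) * tail μ (B 0) k) / c ^ 2) *
          ∫ ω, (if X ω ≤ ⌊m⌋₊ then (X ω : ℝ) else 0) ∂μ := by
  set q := tail μ (B 0) y +
    (∑ k ∈ Finset.range ⌊y⌋₊, (2 * (k : ℝ) + 1) * tail μ (B 0) k) / c ^ 2 with hq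
  have hq0 : 0 ≤ q := add_nonneg (tail_nonneg _ _) (div_nonneg (Finset.sum_nonneg fun k _ =>
    mul_nonneg (by positivity) (tail_nonneg _ _)) (sq_nonneg _))
  have hset := measurableSet_tail hX.measurable_X m
  have hint : Integrable (fun ω => if X ω ≤ ⌊m⌋₊ then (X ω : ℝ) else 0) μ := by
    refine Integrable.of_bound ((measurable_from_top (f := fun n : ℕ =>
      if n ≤ ⌊m⌋₊ then (n : ℝ) else 0)).comp hX.measurable_X).aestronglyMeasurable (⌊m⌋₊ : ℝ)
      (Eventually.of_forall fun ω => ?_)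
    split_ifs with h
    · simpa using h
    · simp
  have hnn : ∀ ω, 0 ≤ if X ω ≤ ⌊m⌋₊ then (X ω : ℝ) else 0 := fun ω => by
    split_ifs <;> simp
  have hind : Integrable ({ω | m < (X ω : ℝ)}.indicator fun _ => (1 : ℝ)) μ :=
    (integrable_const _).indicator hset
  have hpt : ∀ ω', μ {ω | y < ((∑ i ∈ Finset.range (X ω'), B i ω : ℕ) : ℝ)} ≤
      ENNReal.ofReal ({ω | m < (X ω : ℝ)}.indicator (fun _ => (1 : ℝ)) ω' +
        q * if X ω' ≤ ⌊m⌋₊ then (X ω' : ℝ) else 0) := by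
    intro ω'
    rw [← ofReal_measureReal]
    refine ENNReal.ofReal_le_ofReal ?_
    by_cases h : m < (X ω' : ℝ)
    · rw [Set.indicator_of_mem (show ω' ∈ {ω | m < (X ω : ℝ)} from h)]
      exact measureReal_le_one.trans (le_add_of_nonneg_right (mul_nonneg hq0 (hnn _)))
    · rw [Set.indicator_of_notMem (show ω' ∉ {ω | m < (X ω : ℝ)} from h), zero_add,
        if_pos (Nat.le_floor (not_lt.1 h)), mul_comm]
      refine hX.tail_sum_le hb0 hc (le_trans ?_ hmy)
      gcongr
      exact not_lt.1 h
  have hI : 0 ≤ ∫ ω, ({ω | m < (X ω : ℝ)}.indicator (fun _ => (1 : ℝ)) ω +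
      q * if X ω ≤ ⌊m⌋₊ then (X ω : ℝ) else 0) ∂μ :=
    integral_nonneg fun ω => add_nonneg (Set.indicator_nonneg (fun _ _ => zero_le_one) _)
      (mul_nonneg hq0 (hnn _))
  have hle : tail μ (fun ω => ∑ i ∈ Finset.range (X ω), B i ω) y ≤
      ∫ ω, ({ω | m < (X ω : ℝ)}.indicator (fun _ => (1 : ℝ)) ω +
        q * if X ω ≤ ⌊m⌋₊ then (X ω : ℝ) else 0) ∂μ := by
    refine ENNReal.toReal_le_of_le_ofReal hI ?_
    rw [ofReal_integral_eq_lintegral_ofReal]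
    · exact (hX.measure_randomSum y).le.trans (lintegral_mono hpt)
    · exact hind.add (hint.const_mul q)
    · exact Eventually.of_forall fun ω => add_nonneg
        (Set.indicator_nonneg (fun _ _ => zero_le_one) _) (mul_nonneg hq0 (hnn _))
  refine hle.trans_eq ?_
  rw [integral_add hind (hint.const_mul q), integral_const_mul, integral_indicator_const _ hset]
  simp [tail]

/-- Weak law of large numbers for the summands, one-sided. -/
theorem eventually_le_tail_sum (hX : IsStationarySolution μ X A B)
    (hb0 : 0 < ∫ ω, (B 0 ω : ℝ) ∂μ) {d η : ℝ} (hd : d < ∫ ω, (B 0 ω : ℝ) ∂μ) (hη : 0 < η) :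
    ∀ᶠ n : ℕ in atTop, 1 - η ≤ tail μ (fun ω => ∑ i ∈ Finset.range n, B i ω) (d * n) := by
  set b := ∫ ω, (B 0 ω : ℝ) ∂μ with hb
  have hcm : Measurable fun k : ℕ => (k : ℝ) := measurable_from_top
  have hlaw := strong_law_ae_real (μ := μ) (fun i ω => (B i ω : ℝ)) (hX.integrable_B hb0 0)
    (fun i j hij => (hX.iIndep_B.indepFun hij).comp hcm hcm)
    fun i => (hX.identDistrib_B i).comp hcm
  have hmeas := tendstoInMeasure_of_tendsto_ae (fun n => Measurable.aestronglyMeasurable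
    ((Finset.measurable_sum _ fun i _ => hcm.comp (hX.measurable_B i)).div_const _)) hlaw
  rw [tendstoInMeasure_iff_dist] at hmeas
  have h := hmeas (b - d) (sub_pos.2 hd)
  have h' := (h.eventually (gt_mem_nhds (ENNReal.ofReal_pos.2 hη)))
  filter_upwards [h', eventually_gt_atTop 0] with n hn hn0
  have hcompl : tail μ (fun ω => ∑ i ∈ Finset.range n, B i ω) (d * n) =
      1 - μ.real {ω | d * n < ((∑ i ∈ Finset.range n, B i ω : ℕ) : ℝ)}ᶜ := by
    rw [probReal_compl_eq_one_sub (measurableSet_tail (hX.measurable_sum n) _), tail]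
    ring
  rw [hcompl]
  refine sub_le_sub_left (ENNReal.toReal_le_of_le_ofReal hη.le
    ((measure_mono fun ω hω => ?_).trans hn.le)) 1
  have hω' : ((∑ i ∈ Finset.range n, B i ω : ℕ) : ℝ) ≤ d * n := not_lt.1 hω
  have hn0' : (0 : ℝ) < n := by exact_mod_cast hn0
  have h2 : (∑ i ∈ Finset.range n, (B i ω : ℝ)) / n ≤ d := by
    rw [div_le_iff₀ hn0']
    exact_mod_cast hω'
  show b - d ≤ dist ((∑ i ∈ Finset.range n, (B i ω : ℝ)) / n) b
  rw [Real.dist_eq, abs_sub_comm]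
  exact le_trans (by linarith) (le_abs_self _)

/-- Lower bound for the tail of the random sum by that of `X`. -/
theorem eventually_mul_tail_le_tail_randomSum (hX : IsStationarySolution μ X A B)
    (hb0 : 0 < ∫ ω, (B 0 ω : ℝ) ∂μ) {d η : ℝ} (hd0 : 0 < d) (hd : d < ∫ ω, (B 0 ω : ℝ) ∂μ)
    (hη : 0 < η) :
    ∀ᶠ y in atTop, (1 - η) * tail μ X (y / d) ≤
      tail μ (fun ω => ∑ i ∈ Finset.range (X ω), B i ω) y := by
  obtain ⟨n₀, hn₀⟩ := eventually_atTop.1 (hX.eventually_le_tail_sum hb0 hd hη)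
  filter_upwards [eventually_ge_atTop (d * n₀)] with y hy
  have hset := measurableSet_tail hX.measurable_X (y / d)
  -- The case `η ≥ 1` is trivial; otherwise the factor `1 - η` passes through `ENNReal.ofReal`.
  rcases le_or_gt (1 - η) 0 with h1 | h1
  · exact (mul_nonpos_of_nonpos_of_nonneg h1 (tail_nonneg _ _)).trans (tail_nonneg _ _)
  refine (ENNReal.ofReal_le_iff_le_toReal (measure_ne_top _ _)).1 ?_
  rw [hX.measure_randomSum y, ENNReal.ofReal_mul h1.le, tail, ofReal_measureReal,
    ← lintegral_indicator_const hset]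
  refine lintegral_mono fun ω' => ?_
  by_cases h : y / d < (X ω' : ℝ)
  · rw [Set.indicator_of_mem (show ω' ∈ {ω | y / d < (X ω : ℝ)} from h)]
    have hlt : y < d * X ω' := by rwa [div_lt_iff₀' hd0] at h
    have hn : n₀ ≤ X ω' := by
      have : d * (n₀ : ℝ) < d * X ω' := hy.trans_lt hlt
      exact_mod_cast (lt_of_mul_lt_mul_left this hd0.le).le
    refine (ENNReal.ofReal_le_iff_le_toReal (measure_ne_top _ _)).2 ?_
    exact (hn₀ _ hn).trans (tail_antitone _ hlt.le)
  · rw [Set.indicator_of_notMem (show ω' ∉ {ω | y / d < (X ω : ℝ)} from h)]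
    exact zero_le

omit [IsProbabilityMeasure μ] in
theorem indepFun_randomSum (hX : IsStationarySolution μ X A B) :
    IndepFun A (fun ω => ∑ i ∈ Finset.range (X ω), B i ω) μ := by
  have h : Measurable fun p : ℕ × (ℕ → ℕ) => ∑ i ∈ Finset.range p.1, p.2 i :=
    measurable_from_prod_countable_right fun n =>
      show Measurable fun β : ℕ → ℕ => ∑ i ∈ Finset.range n, β i from
        Finset.measurable_sum _ fun i _ => measurable_pi_apply i
  exact hX.indep_A.comp measurable_id h

omit [IsProbabilityMeasure μ] in
theorem measureReal_inter_randomSum (hX : IsStationarySolution μ X A B) (x y : ℝ) :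
    μ.real ({ω | x < (A ω : ℝ)} ∩ {ω | y < ((∑ i ∈ Finset.range (X ω), B i ω : ℕ) : ℝ)}) =
      tail μ A x * tail μ (fun ω => ∑ i ∈ Finset.range (X ω), B i ω) y := by
  have h := hX.indepFun_randomSum.measure_inter_preimage_eq_mul {n : ℕ | x < (n : ℝ)}
    {n : ℕ | y < (n : ℝ)} trivial trivial
  simp only [tail, measureReal_def, ← ENNReal.toReal_mul]
  exact congrArg ENNReal.toReal h

/-- If neither term exceeds `(1 - δ) x` while their sum exceeds `x`, both exceed `δ x`; independence
turns that event into a product. -/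
theorem tail_le_add (hX : IsStationarySolution μ X A B) (x δ : ℝ) :
    tail μ X x ≤ tail μ A ((1 - δ) * x) +
      tail μ (fun ω => ∑ i ∈ Finset.range (X ω), B i ω) ((1 - δ) * x) +
        tail μ A (δ * x) * tail μ (fun ω => ∑ i ∈ Finset.range (X ω), B i ω) (δ * x) := by
  rw [tail_eq_of_identDistrib hX.fixed_point, ← hX.measureReal_inter_randomSum]
  refine le_trans (measureReal_mono ?_) ((measureReal_union_le _ _).trans
    (add_le_add_left (measureReal_union_le _ _) _))
  intro ω (hω : x < ((A ω + ∑ i ∈ Finset.range (X ω), B i ω : ℕ) : ℝ))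
  rw [Nat.cast_add] at hω
  by_cases h1 : (1 - δ) * x < (A ω : ℝ)
  · exact Or.inl (Or.inl h1)
  by_cases h2 : (1 - δ) * x < ((∑ i ∈ Finset.range (X ω), B i ω : ℕ) : ℝ)
  · exact Or.inl (Or.inr h2)
  · exact Or.inr ⟨show δ * x < _ by linarith, show δ * x < _ by linarith⟩

/-- Inclusion-exclusion: both terms are nonnegative, so either one exceeding `x` suffices. -/
theorem add_sub_mul_le_tail (hX : IsStationarySolution μ X A B) (x : ℝ) :
    tail μ A x + tail μ (fun ω => ∑ i ∈ Finset.range (X ω), B i ω) x -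
      tail μ A x * tail μ (fun ω => ∑ i ∈ Finset.range (X ω), B i ω) x ≤ tail μ X x := by
  rw [tail_eq_of_identDistrib hX.fixed_point, ← hX.measureReal_inter_randomSum]
  have h := measureReal_union_add_inter (μ := μ) (s := {ω | x < (A ω : ℝ)})
    (measurableSet_tail hX.measurable_randomSum x)
  have hsub : {ω | x < (A ω : ℝ)} ∪ {ω | x < ((∑ i ∈ Finset.range (X ω), B i ω : ℕ) : ℝ)} ⊆
      {ω | x < ((A ω + ∑ i ∈ Finset.range (X ω), B i ω : ℕ) : ℝ)} := by
    intro ω hω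
    have h0 : (0 : ℝ) ≤ A ω := Nat.cast_nonneg _
    have h1 : (0 : ℝ) ≤ ((∑ i ∈ Finset.range (X ω), B i ω : ℕ) : ℝ) := Nat.cast_nonneg _
    show x < ((A ω + ∑ i ∈ Finset.range (X ω), B i ω : ℕ) : ℝ)
    rw [Nat.cast_add]
    rcases hω with (h : x < (A ω : ℝ)) |
      (h : x < ((∑ i ∈ Finset.range (X ω), B i ω : ℕ) : ℝ)) <;> linarith
  have h3 := measureReal_mono (μ := μ) hsub
  unfold tail
  linarith

end IsStationarySolution

end StationarySolution

/-! ### Scaling recursions and truncated second moments -/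

section Analysis

/-- A function vanishing at infinity that is dominated by its rescaling is nonpositive. -/
theorem nonpos_of_le_mul_comp_div {D : ℝ → ℝ} {θ β x₀ : ℝ} (hθ0 : 0 ≤ θ) (hθ1 : θ ≤ 1)
    (hβ0 : 0 < β) (hβ1 : β < 1) (hx₀ : 0 < x₀) (hD : Tendsto D atTop (𝓝 0))
    (h : ∀ x, x₀ ≤ x → D x ≤ θ * D (x / β)) {x : ℝ} (hx : x₀ ≤ x) : D x ≤ 0 := by
  -- The maximum with `0` is needed because discarding `θ ≤ 1` is legitimate only for nonnegative
  -- values.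
  have hstep : ∀ k : ℕ, ∀ x, x₀ ≤ x → D x ≤ max (D (x / β ^ k)) 0 := by
    intro k
    induction k with
    | zero => intro x _; simp
    | succ k ih =>
      intro x hx
      have hx' : x₀ ≤ x / β := hx.trans (le_div_self (hx₀.le.trans hx) hβ0 hβ1.le)
      have hk := ih _ hx'
      rw [div_div, ← pow_succ'] at hk
      refine (h x hx).trans ((mul_le_mul_of_nonneg_left hk hθ0).trans ?_)
      exact mul_le_of_le_one_left (le_max_right _ _) hθ1
  have hlim : Tendsto (fun k : ℕ => max (D (x / β ^ k)) 0) atTop (𝓝 0) := by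
    have h1 : Tendsto (fun k : ℕ => x / β ^ k) atTop atTop := by
      have := (tendsto_pow_atTop_atTop_of_one_lt ((one_lt_inv₀ hβ0).2 hβ1)).const_mul_atTop
        (hx₀.trans_le hx)
      refine this.congr fun k => ?_
      rw [inv_pow, div_eq_mul_inv]
    have h2 := (hD.comp h1).max (tendsto_const_nhds (x := (0 : ℝ)))
    rwa [max_self] at h2
  exact ge_of_tendsto' hlim fun k => hstep k x hx

/-- If `y log y t(y) → 0`, then the truncated second moments of `t` are `o(y / log y)`. -/
theorem tendsto_sum_mul_log_div {t : ℝ → ℝ} {D : ℝ} (ht : ∀ k : ℕ, 0 ≤ t k)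
    (hD : ∀ k : ℕ, (2 * (k : ℝ) + 1) * t k ≤ D)
    (hlim : Tendsto (fun y => y * Real.log y * t y) atTop (𝓝 0)) :
    Tendsto (fun y : ℝ => (∑ k ∈ Finset.range ⌊y⌋₊, (2 * (k : ℝ) + 1) * t k) * Real.log y / y)
      atTop (𝓝 0) := by
  have hD0 : 0 ≤ D := le_trans (mul_nonneg (by positivity) (ht 0)) (hD 0)
  refine tendsto_order.2 ⟨fun a ha => ?_, fun a ha => ?_⟩
  · filter_upwards [eventually_ge_atTop 1] with y hy
    refine ha.trans_le (div_nonneg (mul_nonneg (Finset.sum_nonneg fun k _ =>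
      mul_nonneg (by positivity) (ht k)) (Real.log_nonneg hy)) (by linarith))
  -- The sum is split at `√y`. Beyond it `2k + 1 ≤ 3k` and `log y ≤ 2 log k`, costing a factor `6`,
  -- so `a / 12` leaves `a / 2`. Below it the uniform bound `D` gives only `O(√y)`.
  obtain ⟨K, hK⟩ := eventually_atTop.1 (hlim.eventually (gt_mem_nhds (show (0 : ℝ) < a / 12 by
    linarith)))
  have hrest : Tendsto (fun y : ℝ => (Real.sqrt y + 1) * D * Real.log y / y) atTop (𝓝 0) := by
    have h1 : Tendsto (fun y : ℝ => Real.log y / y ^ (1 / 2 : ℝ)) atTop (𝓝 0) :=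
      (isLittleO_log_rpow_atTop (by norm_num)).tendsto_div_nhds_zero
    have h2 : Tendsto (fun y : ℝ => Real.log y / y) atTop (𝓝 0) := by
      simpa using Real.isLittleO_log_id_atTop.tendsto_div_nhds_zero
    have h3 := (h1.const_mul D).add (h2.const_mul D)
    rw [mul_zero, add_zero] at h3
    refine h3.congr' ?_
    filter_upwards [eventually_gt_atTop 0] with y hy
    rw [← Real.sqrt_eq_rpow]
    have : (Real.sqrt y + 1) * D * Real.log y / y =
        D * (Real.log y * (Real.sqrt y / y)) + D * (Real.log y / y) := by ring
    rw [this, Real.sqrt_div_self, div_eq_mul_inv]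
  filter_upwards [hrest.eventually (gt_mem_nhds (show (0 : ℝ) < a / 2 by linarith)),
    eventually_ge_atTop (K ^ 2), eventually_gt_atTop 1] with y hy hyK hy1
  have hlog : 0 < Real.log y := Real.log_pos hy1
  have hy0 : 0 < y := by linarith
  have hs1 : 1 < Real.sqrt y := by
    rw [Real.lt_sqrt zero_le_one]; simpa using hy1
  have hpt : ∀ k ∈ Finset.range ⌊y⌋₊, (2 * (k : ℝ) + 1) * t k ≤
      (if k < ⌊Real.sqrt y⌋₊ + 1 then D else 0) + a / 2 / Real.log y := by
    intro k _
    split_ifs with h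
    · exact (hD k).trans (le_add_of_nonneg_right (by positivity))
    · have hk : Real.sqrt y < k := by
        have := Nat.lt_floor_add_one (Real.sqrt y)
        have h' : ((⌊Real.sqrt y⌋₊ + 1 : ℕ) : ℝ) ≤ k := by exact_mod_cast not_lt.1 h
        push_cast at h'
        linarith
      have hKk : K ≤ k := (Real.le_sqrt_of_sq_le hyK).trans hk.le
      have hkt := (hK k hKk).le
      have hlk : Real.log y / 2 ≤ Real.log k := by
        rw [← Real.log_sqrt hy0.le]
        exact Real.log_le_log (by linarith) hk.le
      rw [zero_add, le_div_iff₀ hlog]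
      have h1k : (1 : ℝ) ≤ k := by linarith
      have h3 : (2 * (k : ℝ) + 1) * t k * Real.log y ≤ (3 * k) * t k * (2 * Real.log k) := by
        have := ht k
        gcongr <;> linarith
      nlinarith
  have hsum : ∑ k ∈ Finset.range ⌊y⌋₊, (2 * (k : ℝ) + 1) * t k ≤
      (Real.sqrt y + 1) * D + y * (a / 2 / Real.log y) := by
    refine (Finset.sum_le_sum hpt).trans ?_
    rw [Finset.sum_add_distrib, sum_range_ite_lt (fun _ => D)]
    simp only [Finset.sum_const, Finset.card_range, nsmul_eq_mul]
    have h1 : ((min (⌊Real.sqrt y⌋₊ + 1) ⌊y⌋₊ : ℕ) : ℝ) ≤ Real.sqrt y + 1 := by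
      refine le_trans (Nat.cast_le.2 (min_le_left _ _)) ?_
      push_cast
      have := Nat.floor_le (Real.sqrt_nonneg y)
      linarith
    have h2 : (⌊y⌋₊ : ℝ) ≤ y := Nat.floor_le hy0.le
    gcongr
  calc (∑ k ∈ Finset.range ⌊y⌋₊, (2 * (k : ℝ) + 1) * t k) * Real.log y / y
      ≤ ((Real.sqrt y + 1) * D + y * (a / 2 / Real.log y)) * Real.log y / y := by gcongr
    _ = (Real.sqrt y + 1) * D * Real.log y / y + a / 2 := by field_simp
    _ < a := by linarith

end Analysis

/-! ### Matching upper and lower bounds for the tail of `X` -/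

section StationarySolution

variable {Ω : Type*} [MeasurableSpace Ω] {μ : Measure Ω} [IsProbabilityMeasure μ]
  {X A : Ω → ℕ} {B : ℕ → Ω → ℕ}

theorem exists_sum_tail_le_log {Y : Ω → ℕ}
    (hY : Tendsto (fun x => x * tail μ Y x) atTop (𝓝 1)) :
    ∃ C, 0 ≤ C ∧ ∀ M : ℕ, ∑ k ∈ Finset.range M, tail μ Y k ≤ C * (1 + Real.log M) := by
  obtain ⟨K, hK⟩ := eventually_atTop.1 (hY.eventually (gt_mem_nhds (show (1 : ℝ) < 2 by norm_num)))
  have hbd : ∀ k : ℕ, tail μ Y k ≤ (|K| + 4) * ((k : ℝ) + 1)⁻¹ := by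
    intro k
    have hk : (0 : ℝ) ≤ k := Nat.cast_nonneg k
    have hKa := le_abs_self K
    have hKb := abs_nonneg K
    rw [← div_eq_mul_inv, le_div_iff₀ (by positivity)]
    have h1 := tail_le_one (μ := μ) Y k
    have h0 := tail_nonneg (μ := μ) Y k
    rcases le_or_gt K k with h | h
    · have := hK k h
      nlinarith
    · nlinarith
  refine ⟨|K| + 4, by positivity, fun M => (Finset.sum_le_sum fun k _ => hbd k).trans ?_⟩
  rw [← Finset.mul_sum]
  refine mul_le_mul_of_nonneg_left ?_ (by positivity)
  refine le_trans (le_of_eq ?_) (harmonic_le_one_add_log M)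
  simp [harmonic]

namespace IsStationarySolution

theorem eventually_tail_le (hX : IsStationarySolution μ X A B)
    (hb0 : 0 < ∫ ω, (B 0 ω : ℝ) ∂μ) (hb1 : ∫ ω, (B 0 ω : ℝ) ∂μ < 1)
    (hA : Tendsto (fun x => x * tail μ A x) atTop (𝓝 1))
    (hB : Tendsto (fun x => x * Real.log x * tail μ (B 0) x) atTop (𝓝 0))
    {K : ℝ} (hK : 1 / (1 - ∫ ω, (B 0 ω : ℝ) ∂μ) < K) :
    ∀ᶠ x in atTop, tail μ X x ≤ K / x := by
  set b := ∫ ω, (B 0 ω : ℝ) ∂μ with hb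
  -- At `δ = 0` the first condition reads `1 < K (1 - b)`. One factor `1 - δ` in the square comes
  -- from splitting `A + S` at `(1 - δ) x`, the other from the Chebyshev margin `c = δ y`.
  obtain ⟨δ, ⟨hδK, hδb⟩, hδ1, hδ0⟩ : ∃ δ : ℝ,
      (1 / (1 - δ) < K * (1 - b / (1 - δ) ^ 2) ∧ b / (1 - δ) ^ 2 < 1) ∧ δ < 1 ∧ 0 < δ := by
    have hc1 : ContinuousAt (fun δ : ℝ => 1 / (1 - δ)) 0 := by
      fun_prop (disch := norm_num)
    have hc2 : ContinuousAt (fun δ : ℝ => b / (1 - δ) ^ 2) 0 := by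
      fun_prop (disch := norm_num)
    have hc3 : ContinuousAt (fun δ : ℝ => K * (1 - b / (1 - δ) ^ 2)) 0 :=
      continuousAt_const.mul (continuousAt_const.sub hc2)
    have e1 : ∀ᶠ δ in 𝓝 (0 : ℝ), 1 / (1 - δ) < K * (1 - b / (1 - δ) ^ 2) := by
      refine hc1.eventually_lt hc3 ?_
      rw [div_lt_iff₀ (by linarith)] at hK
      norm_num
      exact hK
    have e2 : ∀ᶠ δ in 𝓝 (0 : ℝ), b / (1 - δ) ^ 2 < 1 :=
      hc2.eventually_lt continuousAt_const (by norm_num; exact hb1)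
    have e3 : ∀ᶠ δ in 𝓝 (0 : ℝ), δ < 1 := gt_mem_nhds one_pos
    have e := ((e1.and e2).and e3).filter_mono (nhdsWithin_le_nhds (s := Set.Ioi 0))
    obtain ⟨δ, h, h'⟩ := (e.and self_mem_nhdsWithin).exists
    exact ⟨δ, h.1, h.2, h'⟩
  have hδ1' : 0 < 1 - δ := by linarith
  set β := b / (1 - δ) ^ 2 with hβ
  have hβ0 : 0 < β := by positivity
  obtain ⟨C, hC0, hC⟩ := exists_sum_tail_le_log hA
  set S : Ω → ℕ := fun ω => ∑ i ∈ Finset.range (X ω), B i ω with hS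
  set V : ℝ → ℝ := fun y => ∑ k ∈ Finset.range ⌊y⌋₊, (2 * (k : ℝ) + 1) * tail μ (B 0) k with hV
  have hVlim : Tendsto (fun y => V y * Real.log y / y) atTop (𝓝 0) := by
    refine tendsto_sum_mul_log_div (D := 2 * b + 1) (fun k => tail_nonneg _ _) (fun k => ?_) hB
    have h1 := mul_tail_le_integral (hX.integrable_B hb0 0) (Nat.cast_nonneg (α := ℝ) k)
    have h2 := tail_le_one (μ := μ) (B 0) k
    rw [← hb] at h1
    nlinarith
  have hscale : Tendsto (fun x : ℝ => (1 - δ) * x) atTop atTop :=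
    tendsto_id.const_mul_atTop hδ1'
  set κ := (1 - δ) / b with hκ
  have hκ0 : 0 < κ := by positivity
  have hlogratio : Tendsto (fun y : ℝ => (1 + Real.log (κ * y)) / Real.log y) atTop (𝓝 1) := by
    have h1 := (tendsto_const_nhds (x := 1 + Real.log κ)).div_atTop Real.tendsto_log_atTop
    have h2 := h1.add_const 1
    rw [zero_add] at h2
    refine h2.congr' ?_
    filter_upwards [eventually_gt_atTop 1] with y hy
    have := Real.log_pos hy
    rw [Real.log_mul hκ0.ne' (by linarith)]
    field_simp
    ring
  -- The logarithm from the truncated mean of `X` is absorbed by the one in the hypothesis on `B`.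
  have hq : Tendsto (fun y : ℝ => y * ((tail μ (B 0) y + V y / (δ * y) ^ 2) *
      (1 / (1 - b) * (C * (1 + Real.log (κ * y)))))) atTop (𝓝 0) := by
    have h1 := ((hB.add (hVlim.const_mul (1 / δ ^ 2))).mul hlogratio).mul_const (C / (1 - b))
    simp only [mul_zero, add_zero, zero_mul] at h1
    refine h1.congr' ?_
    filter_upwards [eventually_gt_atTop 1] with y hy
    have := (Real.log_pos hy).ne'
    have : y ≠ 0 := by linarith
    have : 1 - b ≠ 0 := by linarith
    field_simp
  have hrem : Tendsto (fun x : ℝ => x * (tail μ A ((1 - δ) * x) +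
      (tail μ (B 0) ((1 - δ) * x) + V ((1 - δ) * x) / (δ * ((1 - δ) * x)) ^ 2) *
        (1 / (1 - b) * (C * (1 + Real.log (κ * ((1 - δ) * x))))) +
      tail μ A (δ * x) * tail μ S (δ * x))) atTop (𝓝 (1 / (1 - δ))) := by
    have h1 := (hA.comp hscale).const_mul (1 / (1 - δ))
    have h2 := (hq.comp hscale).const_mul (1 / (1 - δ))
    have hscale' : Tendsto (fun x : ℝ => δ * x) atTop atTop := tendsto_id.const_mul_atTop hδ0
    have h3 := ((hA.mul (tendsto_tail (μ := μ) hX.measurable_randomSum)).comp hscale').const_mul (1 / δ)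
    have h4 := (h1.add h2).add h3
    simp only [mul_one, mul_zero, add_zero] at h4
    refine h4.congr fun x => ?_
    simp only [Function.comp_apply]
    field_simp
    ring
  have hD : Tendsto (fun x => tail μ X x - K / x) atTop (𝓝 0) := by
    simpa using (tendsto_tail hX.measurable_X).sub (tendsto_const_nhds.div_atTop tendsto_id)
  obtain ⟨x₀, hx₀⟩ := eventually_atTop.1 (hrem.eventually (gt_mem_nhds hδK))
  filter_upwards [eventually_ge_atTop (max x₀ 1)] with x hx
  refine sub_nonpos.1 (nonpos_of_le_mul_comp_div (θ := 1) zero_le_one le_rfl hβ0 hδb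
    (lt_max_of_lt_right one_pos) hD (fun x hx => ?_) hx)
  have hx1 : 1 ≤ x := (le_max_right _ _).trans hx
  have hx0 : 0 < x := by linarith
  have hr := (hx₀ x ((le_max_left _ _).trans hx)).le
  have hm : κ * ((1 - δ) * x) = x / β := by
    rw [hκ, hβ]; field_simp
  have hm1 : 1 ≤ x / β := by
    rw [le_div_iff₀ hβ0]; linarith
  have h1 := hX.tail_le_add x δ
  have h2 := hX.tail_randomSum_le hb0 (m := x / β) (y := (1 - δ) * x) (c := δ * ((1 - δ) * x))
    (by positivity) (le_of_eq (by rw [← hb, hβ]; field_simp; ring))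
  have h3 : ∫ ω, (if X ω ≤ ⌊x / β⌋₊ then (X ω : ℝ) else 0) ∂μ ≤
      1 / (1 - b) * (C * (1 + Real.log (κ * ((1 - δ) * x)))) := by
    have h := (hX.one_sub_mul_integral_truncated_le hb0 hb1 ⌊x / β⌋₊).trans (hC _)
    rw [← hb] at h
    rw [one_div, ← div_eq_inv_mul, le_div_iff₀' (by linarith), hm]
    refine h.trans (mul_le_mul_of_nonneg_left ?_ hC0)
    have hfl : 0 < ⌊x / β⌋₊ := Nat.floor_pos.2 hm1
    have := Real.log_le_log (by exact_mod_cast hfl) (Nat.floor_le (by positivity : 0 ≤ x / β))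
    linarith
  have hq0 : 0 ≤ tail μ (B 0) ((1 - δ) * x) + V ((1 - δ) * x) / (δ * ((1 - δ) * x)) ^ 2 :=
    add_nonneg (tail_nonneg _ _) (div_nonneg (Finset.sum_nonneg fun k _ =>
      mul_nonneg (by positivity) (tail_nonneg _ _)) (sq_nonneg _))
  have h4 := mul_le_mul_of_nonneg_left h3 hq0
  -- The comparison function `K / x` gains this much per step, more than the remainder, which is
  -- below `K (1 - β) / x` by the choice of `δ`.
  have h5 : K / x - K / (x / β) = K * (1 - β) / x := by field_simp
  have h6 := (le_div_iff₀' hx0).2 hr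
  rw [one_mul]
  linarith

theorem eventually_le_tail (hX : IsStationarySolution μ X A B)
    (hb0 : 0 < ∫ ω, (B 0 ω : ℝ) ∂μ) (hb1 : ∫ ω, (B 0 ω : ℝ) ∂μ < 1)
    (hA : Tendsto (fun x => x * tail μ A x) atTop (𝓝 1))
    {K : ℝ} (hK : K < 1 / (1 - ∫ ω, (B 0 ω : ℝ) ∂μ)) :
    ∀ᶠ x in atTop, K / x ≤ tail μ X x := by
  set b := ∫ ω, (B 0 ω : ℝ) ∂μ with hb
  -- On the right, one factor `1 - η` is the loss in the tail of `A`, the other the product term in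
  -- inclusion-exclusion. On the left they come from the law of large numbers and from `d < b`.
  obtain ⟨η, hηK, hη1, hη0⟩ : ∃ η : ℝ,
      K * (1 - (1 - η) * (b * (1 - η))) < (1 - η) * (1 - η) ∧ η < 1 ∧ 0 < η := by
    have e1 : ∀ᶠ η in 𝓝 (0 : ℝ), K * (1 - (1 - η) * (b * (1 - η))) < (1 - η) * (1 - η) := by
      refine ContinuousAt.eventually_lt (by fun_prop) (by fun_prop) ?_
      rw [lt_div_iff₀ (by linarith)] at hK
      simpa using hK
    have e3 : ∀ᶠ δ in 𝓝 (0 : ℝ), δ < 1 := gt_mem_nhds one_pos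
    have e := (e1.and e3).filter_mono (nhdsWithin_le_nhds (s := Set.Ioi 0))
    obtain ⟨δ, h, h'⟩ := (e.and self_mem_nhdsWithin).exists
    exact ⟨δ, h.1, h.2, h'⟩
  have hη1' : 0 < 1 - η := by linarith
  set d := b * (1 - η) with hd
  have hd0 : 0 < d := by positivity
  have hdb : d < b := by rw [hd]; nlinarith
  set S : Ω → ℕ := fun ω => ∑ i ∈ Finset.range (X ω), B i ω with hS
  have hD : Tendsto (fun x => K / x - tail μ X x) atTop (𝓝 0) := by
    simpa using (tendsto_const_nhds.div_atTop tendsto_id).sub (tendsto_tail hX.measurable_X)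
  have hA' := hA.eventually (lt_mem_nhds (show 1 - η < 1 by linarith))
  have hS' := (tendsto_tail (μ := μ) hX.measurable_randomSum).eventually (gt_mem_nhds hη0)
  obtain ⟨x₀, hx₀⟩ := eventually_atTop.1 ((hA'.and hS').and
    (hX.eventually_mul_tail_le_tail_randomSum hb0 hd0 hdb hη0))
  filter_upwards [eventually_ge_atTop (max x₀ 1)] with x hx
  refine sub_nonpos.1 (nonpos_of_le_mul_comp_div (θ := 1 - η) hη1'.le (by linarith) hd0
    (hdb.trans hb1) (lt_max_of_lt_right one_pos) hD (fun x hx => ?_) hx)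
  have hx0 : 0 < x := lt_of_lt_of_le one_pos ((le_max_right _ _).trans hx)
  obtain ⟨⟨h1, h2⟩, h3⟩ := hx₀ x ((le_max_left _ _).trans hx)
  have h4 := hX.add_sub_mul_le_tail x
  have h5 : (1 - η) * ((1 - η) / x) ≤ (1 - η) * tail μ A x :=
    mul_le_mul_of_nonneg_left ((div_le_iff₀' hx0).2 h1.le) hη1'.le
  have h6 : tail μ A x * tail μ S x ≤ tail μ A x * η :=
    mul_le_mul_of_nonneg_left h2.le (tail_nonneg _ _)
  have h7 : K / x - (1 - η) * (K / (x / d)) ≤ (1 - η) * ((1 - η) / x) := by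
    have e1 : K / x - (1 - η) * (K / (x / d)) = K * (1 - (1 - η) * d) / x := by
      field_simp
    have e2 : (1 - η) * ((1 - η) / x) = (1 - η) * (1 - η) / x := by ring
    rw [e1, e2]
    gcongr
  linarith

/-- The tail of the stationary solution. -/
theorem tendsto_mul_tail (hX : IsStationarySolution μ X A B)
    (hb0 : 0 < ∫ ω, (B 0 ω : ℝ) ∂μ) (hb1 : ∫ ω, (B 0 ω : ℝ) ∂μ < 1)
    (hA : Tendsto (fun x => x * tail μ A x) atTop (𝓝 1))
    (hB : Tendsto (fun x => x * Real.log x * tail μ (B 0) x) atTop (𝓝 0)) :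
    Tendsto (fun x => x * tail μ X x) atTop (𝓝 (1 / (1 - ∫ ω, (B 0 ω : ℝ) ∂μ))) := by
  refine tendsto_order.2 ⟨fun K hK => ?_, fun K hK => ?_⟩
  · obtain ⟨K', h1, h2⟩ := exists_between hK
    filter_upwards [hX.eventually_le_tail hb0 hb1 hA h2, eventually_gt_atTop 0] with x hx hx0
    exact h1.trans_le ((div_le_iff₀' hx0).1 hx)
  · obtain ⟨K', h1, h2⟩ := exists_between hK
    filter_upwards [hX.eventually_tail_le hb0 hb1 hA hB h1, eventually_gt_atTop 0] with x hx hx0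
    exact ((le_div_iff₀' hx0).1 hx).trans_lt h2

end IsStationarySolution

end StationarySolution

/-! ### The coefficient series -/

section Refinement

theorem refinementTerm_eq {b x : ℝ} (hb : 0 < b) (hx : 0 < x) (n : ℕ) :
    refinementTerm b x n =
      ((n : ℝ) + 1) * b ^ n * Real.log x + ((n : ℝ) + 1) ^ 2 * b ^ n * -Real.log b := by
  rw [refinementTerm, Real.log_div hx.ne' (by positivity), Real.log_pow]
  push_cast
  ring

theorem summable_add_one_mul_geometric {b : ℝ} (hb0 : 0 < b) (hb1 : b < 1) :
    Summable fun n : ℕ => ((n : ℝ) + 1) * b ^ n := by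
  have hb : ‖b‖ < 1 := by rwa [Real.norm_of_nonneg hb0.le]
  have h1 := summable_pow_mul_geometric_of_norm_lt_one 1 hb
  have h0 := summable_pow_mul_geometric_of_norm_lt_one 0 hb
  exact (h1.add h0).congr fun n => by ring

theorem summable_add_one_sq_mul_geometric {b : ℝ} (hb0 : 0 < b) (hb1 : b < 1) :
    Summable fun n : ℕ => ((n : ℝ) + 1) ^ 2 * b ^ n := by
  have hb : ‖b‖ < 1 := by rwa [Real.norm_of_nonneg hb0.le]
  have h2 := summable_pow_mul_geometric_of_norm_lt_one 2 hb
  have h1 := summable_add_one_mul_geometric hb0 hb1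
  have h0 := summable_pow_mul_geometric_of_norm_lt_one 0 hb
  exact ((h2.add (h1.mul_left 2)).sub h0).congr fun n => by ring

theorem summable_refinementTerm {b x : ℝ} (hb0 : 0 < b) (hb1 : b < 1) (hx : 0 < x) :
    Summable (refinementTerm b x) :=
  (((summable_add_one_mul_geometric hb0 hb1).mul_right _).add
    ((summable_add_one_sq_mul_geometric hb0 hb1).mul_right _)).congr
      fun n => (refinementTerm_eq hb0 hx n).symm

/-- The refinement coefficient is an affine function of `log x`. -/
theorem refinementCoeff_eq {b x : ℝ} (hb0 : 0 < b) (hb1 : b < 1) (hx : 0 < x) :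
    refinementCoeff b x = (∑' n : ℕ, ((n : ℝ) + 1) * b ^ n) * Real.log x +
      (∑' n : ℕ, ((n : ℝ) + 1) ^ 2 * b ^ n) * -Real.log b := by
  have h1 := summable_add_one_mul_geometric hb0 hb1
  have h2 := summable_add_one_sq_mul_geometric hb0 hb1
  rw [refinementCoeff, tsum_congr fun n => refinementTerm_eq hb0 hx n,
    (h1.mul_right _).tsum_add (h2.mul_right _), tsum_mul_right, tsum_mul_right]

/-- The coefficient of `log x` is positive, so the constant part of the affine function is
negligible. -/
theorem refinementCoeff_isEquivalent {b : ℝ} (hb0 : 0 < b) (hb1 : b < 1) :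
    refinementCoeff b ~[atTop] fun x => (∑' n : ℕ, ((n : ℝ) + 1) * b ^ n) * Real.log x := by
  have hc : 0 < ∑' n : ℕ, ((n : ℝ) + 1) * b ^ n :=
    (summable_add_one_mul_geometric hb0 hb1).tsum_pos (fun n => by positivity) 0 (by simp)
  have ho : (fun _ : ℝ => (∑' n : ℕ, ((n : ℝ) + 1) ^ 2 * b ^ n) * -Real.log b) =o[atTop]
      fun x => (∑' n : ℕ, ((n : ℝ) + 1) * b ^ n) * Real.log x :=
    isLittleO_const_left.2 (Or.inr
      (tendsto_norm_atTop_atTop.comp (Real.tendsto_log_atTop.const_mul_atTop hc)))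
  refine (IsEquivalent.refl.add_isLittleO ho).congr_left ?_
  filter_upwards [eventually_gt_atTop 0] with x hx
  exact (refinementCoeff_eq hb0 hb1 hx).symm

theorem refinementCoeff_isTheta_log {b : ℝ} (hb0 : 0 < b) (hb1 : b < 1) :
    refinementCoeff b =Θ[atTop] Real.log := by
  have hc : (∑' n : ℕ, ((n : ℝ) + 1) * b ^ n) ≠ 0 :=
    ((summable_add_one_mul_geometric hb0 hb1).tsum_pos (fun n => by positivity) 0 (by simp)).ne'
  exact (refinementCoeff_isEquivalent hb0 hb1).isTheta.trans
    ((isTheta_const_mul_left hc).2 isTheta_rfl)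

end Refinement

/-! ### Normalising the hypotheses and the final assembly -/

theorem tendsto_mul_log_zero {L : ℝ → ℝ} {ε : ℝ} (hε : 0 < ε)
    (hL : L ~[atTop] fun x => Real.log x ^ (-1 - ε)) :
    Tendsto (fun x => L x * Real.log x) atTop (𝓝 0) := by
  have h := (hL.mul (IsEquivalent.refl (u := Real.log))).symm
  refine h.tendsto_nhds ?_
  -- One logarithm cancels, leaving `(log x) ^ (-ε)`; this is where `ε > 0` enters.
  refine ((tendsto_rpow_neg_atTop hε).comp Real.tendsto_log_atTop).congr' ?_
  filter_upwards [eventually_gt_atTop 1] with x hx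
  have hl := Real.log_pos hx
  show Real.log x ^ (-ε) = Real.log x ^ (-1 - ε) * Real.log x
  rw [← Real.rpow_add_one hl.ne']
  congr 1
  ring

theorem tendsto_mul_one_div_one_add : Tendsto (fun x : ℝ => x * (1 / (1 + x))) atTop (𝓝 1) := by
  have h := (tendsto_const_nhds (x := (1 : ℝ))).div_atTop (tendsto_atTop_add_const_left atTop 1
    (tendsto_id (α := ℝ)))
  have h' := h.const_sub 1
  rw [sub_zero] at h'
  refine h'.congr' ?_
  filter_upwards [eventually_gt_atTop 0] with x hx
  simp only [id]
  field_simp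
  ring

theorem mainTheorem1 {Ω : Type*} [MeasurableSpace Ω] (μ : Measure Ω) [IsProbabilityMeasure μ]
    (X A : Ω → ℕ) (B : ℕ → Ω → ℕ) (hX : IsStationarySolution μ X A B)
    (L : ℝ → ℝ) (hL : IsSlowlyVarying L) (ε : ℝ) (hε : 0 < ε)
    (hA : tail μ A ~[atTop] fun x => 1 / (1 + x))
    (hB : ∀ x : ℝ, 0 < x → tail μ (B 0) x = L x / (1 + x))
    (hLlog : L ~[atTop] fun x => Real.log x ^ (-1 - ε))
    (b : ℝ) (hb : b = ∫ ω, (B 0 ω : ℝ) ∂μ) (hb0 : 0 < b) (hb1 : b < 1) :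
    -- leading tail
    (tail μ X ~[atTop] fun x => 1 / (1 - b) * tail μ A x) ∧
    (tail μ X ~[atTop] fun x => 1 / ((1 - b) * (1 + x))) ∧
    -- two-scale form, for every choice of the `o(1)` term
    (∀ x : ℝ, 0 < x → Summable (refinementTerm b x)) ∧
    (∀ r : ℝ → ℝ, Tendsto r atTop (𝓝 0) →
      tail μ X ~[atTop] fun x =>
        1 / ((1 - b) * (1 + x)) + refinementCoeff b x * (L x / (1 + x)) * (1 + r x)) ∧
    -- order of the correction term, and its negligibility
    ((fun x => refinementCoeff b x * (L x / (1 + x))) =Θ[atTop]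
      fun x => L x * Real.log x / (1 + x)) ∧
    ((fun x => L x * Real.log x / (1 + x)) =o[atTop] fun x => 1 / (1 + x)) := by
  have hint0 : 0 < ∫ ω, (B 0 ω : ℝ) ∂μ := hb ▸ hb0
  have hint1 : ∫ ω, (B 0 ω : ℝ) ∂μ < 1 := hb ▸ hb1
  have h1b : 0 < 1 - b := by linarith
  have hone : Tendsto (fun x : ℝ => 1 + x) atTop atTop :=
    tendsto_atTop_add_const_left atTop 1 tendsto_id
  have hLl := tendsto_mul_log_zero hε hLlog
  have hA' : Tendsto (fun x => x * tail μ A x) atTop (𝓝 1) :=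
    ((IsEquivalent.refl (u := fun x : ℝ => x)).mul hA).symm.tendsto_nhds
      tendsto_mul_one_div_one_add
  have hB' : Tendsto (fun x => x * Real.log x * tail μ (B 0) x) atTop (𝓝 0) := by
    have h := hLl.mul tendsto_mul_one_div_one_add
    rw [zero_mul] at h
    refine h.congr' ?_
    filter_upwards [eventually_gt_atTop 0] with x hx
    rw [hB x hx]
    ring
  have hXlim := hX.tendsto_mul_tail hint0 hint1 hA' hB'
  rw [← hb] at hXlim
  have hmain : tail μ X ~[atTop] fun x => 1 / ((1 - b) * (1 + x)) := by
    have h : (fun x => x * tail μ X x) ~[atTop] fun x => 1 / (1 - b) * (x * (1 / (1 + x))) := by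
      have h0 := (one_div_pos.2 h1b).ne'
      have h2 := tendsto_mul_one_div_one_add.const_mul (1 / (1 - b))
      rw [mul_one] at h2
      exact ((isEquivalent_const_iff_tendsto h0).2 hXlim).trans
        ((isEquivalent_const_iff_tendsto h0).2 h2).symm
    have h' := (IsEquivalent.refl (u := fun x : ℝ => x⁻¹)).mul h
    refine (h'.congr_left ?_).congr_right ?_
    · filter_upwards [eventually_gt_atTop 0] with x hx
      simp only [Pi.mul_apply]
      field_simp
    · filter_upwards [eventually_gt_atTop 0] with x hx
      simp only [Pi.mul_apply]
      field_simp
  have hneg : (fun x => L x * Real.log x / (1 + x)) =o[atTop] fun x => 1 / (1 + x) := by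
    refine (((isLittleO_one_iff ℝ).2 hLl).mul_isBigO
      (isBigO_refl (fun x : ℝ => 1 / (1 + x)) atTop)).congr (fun x => ?_) fun x => ?_ <;> ring
  have hcorr : (fun x => refinementCoeff b x * (L x / (1 + x))) =Θ[atTop]
      fun x => L x * Real.log x / (1 + x) := by
    exact ((refinementCoeff_isTheta_log hb0 hb1).mul
      (isTheta_refl (fun x => L x / (1 + x)) atTop)).trans_eventuallyEq
        (Eventually.of_forall fun x => by ring)
  refine ⟨?_, hmain, fun x hx => summable_refinementTerm hb0 hb1 hx, fun r hr => ?_, hcorr, hneg⟩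
  · refine hmain.trans ?_
    refine ((IsEquivalent.refl (u := fun _ : ℝ => 1 / (1 - b))).mul hA).symm.congr_left ?_
    refine Eventually.of_forall fun x => ?_
    simp only [Pi.mul_apply]
    field_simp
  -- The factor `1 + r` is bounded, so the whole correction stays `o(1 / (1 + x))` and is absorbed
  -- by the leading term.
  · have hr1 : (fun x => 1 + r x) =O[atTop] fun _ : ℝ => (1 : ℝ) :=
      (hr.const_add 1).isBigO_one ℝ
    have hscale : (fun x : ℝ => 1 / (1 + x)) =O[atTop] fun x => 1 / ((1 - b) * (1 + x)) := by
      refine (isBigO_const_mul_self (1 - b) (fun x : ℝ => 1 / ((1 - b) * (1 + x))) atTop).congr_left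
        fun x => ?_
      field_simp
    have ho := ((hcorr.trans_isLittleO hneg).mul_isBigO hr1).trans_isBigO
      ((hscale.congr_left fun x => (mul_one _).symm))
    exact hmain.trans (IsEquivalent.refl.add_isLittleO ho).symm
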